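/- Consider $n$ agents and allocation vectors $x\in\{0,1\}^n$ ($x_i=1$ if agent $i$ is served). Let $\mathcal X\subseteq\{0,1\}^n$ be the set of feasible allocations (for instance $\mathcal X=\{0,1\}^n$) and let $c:\{0,1\}^n\to\mathbb R$ be an arbitrary service cost. The valuations $v_1,\dots,v_n$ are independent, and $v_i$ has a distribution with support $[0,b_i]$, $0<b_i<\infty$, with a density $f_i$ that is positive throughout $[0,b_i]$, and with distribution function $F_i$. The virtual valuation for utility of agent $i$ is $\vartheta_i(z)=\frac{1-F_i(z)}{f_i(z)}$. Put $h_i(q)=\vartheta_i(F_i^{-1}(q))$ and $H_i(q)=\int_0^q h_i(r)\,dr$ for $q\in[0,1]$, let $G_i$ be the largest convex function on $[0,1]$ with $G_i\le H_i$, and let $g_i$ be the derivative of $G_i$ where it exists, extended by right-continuity (on $[0,1)$; at $q=1$ take the left derivative). The ironed virtual valuation for utility is $\bar\vartheta_i(z)=g_i(F_i(z))$. A (direct, possibly randomized) mechanism assigns to each reported profile $v$ a random feasible allocation $x(v)\in\mathcal X$ and payments $p_1(v),\dots,p_n(v)\ge 0$, which are burnt (no positive transfers to the agents). Write $x_i(z)$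 and $p_i(z)$ for the probability that agent $i$ is served and its expected payment when it reports $z$ and the other agents report their random valuations. The mechanism has to be Bayesian incentive compatible, $z\,x_i(z)-p_i(z)\ge z\,x_i(w)-p_i(w)$ for all $i$ and all $z,w\in[0,b_i]$, and ex interim individually rational, $z\,x_i(z)-p_i(z)\ge 0$ for all $i$ and all $z\in[0,b_i]$. Its expected residual surplus is $\mathbf E\big[\sum_i (v_i x_i(v)-p_i(v))-c(x(v))\big]$. Theorem. Suppose that a mechanism satisfies the following two conditions. 1. For almost every valuation profile $v$ (in particular, if this holds for every $v$), every allocation that $x(v)$ takes with positive probability lies in $\arg\max_{x'\in\mathcal X}\ \sum_i\bar\vartheta_i(v_i)\,x'_i-c(x')$. 2. For every agent $i$ and every $z\in(0,b_i)$: if $\bar\vartheta_i$ is differentiable at $z$ with $\frac{d}{dz}\bar\vartheta_i(z)=0$, then $x_i(\cdot)$ is differentiable at $z$ with $\frac{d}{dz}x_i(z)=0$. Then the mechanism is optimal: no mechanism has a larger expected residual surplus. -/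

import Mathlib

open MeasureTheory

noncomputable section

namespace MoneyBurning

/-- The distribution of one agent's valuation: it has support `[0, b]` and a density `f` which is
positive throughout this interval (no continuity of `f` is assumed). -/
structure ValuationDist where
  b : ℝ
  f : ℝ → ℝ
  b_pos : 0 < b
  measurable_f : Measurable f
  f_pos : ∀ z ∈ Set.Icc 0 b, 0 < f z
  f_zero : ∀ z, z ∉ Set.Icc 0 b → f z = 0
  lintegral_f : ∫⁻ z, ENNReal.ofReal (f z) = 1

namespace ValuationDist

/-- The probability measure on `ℝ` with density `f`. -/
def law (D : ValuationDist) : Measure ℝ :=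
  volume.withDensity fun z => ENNReal.ofReal (D.f z)

instance (D : ValuationDist) : IsProbabilityMeasure D.law :=
  ⟨by rw [law, withDensity_apply _ MeasurableSet.univ, Measure.restrict_univ, D.lintegral_f]⟩

/-- The cumulative distribution function `F`. -/
def F (D : ValuationDist) (z : ℝ) : ℝ := ProbabilityTheory.cdf D.law z

/-- The inverse `F⁻¹ : [0, 1] → [0, b]` of the cumulative distribution function, which is
continuous and strictly increasing on `[0, b]`. -/
def Finv (D : ValuationDist) (q : ℝ) : ℝ := sInf {z | z ∈ Set.Icc 0 D.b ∧ q ≤ D.F z}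

/-- The virtual valuation for utility, `ϑ(z) = (1 - F(z)) / f(z)`. -/
def virtualValue (D : ValuationDist) (z : ℝ) : ℝ := (1 - D.F z) / D.f z

/-- `h(q) = ϑ(F⁻¹(q))`. -/
def h (D : ValuationDist) (q : ℝ) : ℝ := D.virtualValue (D.Finv q)

/-- `H(q) = ∫₀^q h(r) dr`. -/
def H (D : ValuationDist) (q : ℝ) : ℝ := ∫ r in (0 : ℝ)..q, D.h r

/-- `G` is the convex hull of `H`: the largest convex function on `[0, 1]` that is bounded above
by `H` on `[0, 1]`. -/
def G (D : ValuationDist) (q : ℝ) : ℝ :=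
  sSup {y | ∃ φ : ℝ → ℝ, ConvexOn ℝ (Set.Icc 0 1) φ ∧
    (∀ r ∈ Set.Icc (0 : ℝ) 1, φ r ≤ D.H r) ∧ y = φ q}

/-- `g` is the derivative of the convex function `G` where it exists, extended by right-continuity;
that is, the right derivative of `G` on `[0, 1)`. At the end point `q = 1` it is the left
derivative. -/
def g (D : ValuationDist) (q : ℝ) : ℝ :=
  if q < 1 then derivWithin D.G (Set.Ioi q) q else derivWithin D.G (Set.Iio q) q

/-- The ironed virtual valuation for utility, `ϑ̄(z) = g(F(z))`. -/
def ironed (D : ValuationDist) (z : ℝ) : ℝ := D.g (D.F z)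

end ValuationDist

/-- An allocation says for every agent whether it is served. -/
abbrev Allocation (n : ℕ) := Fin n → Bool

/-- The `0`-`1` entry `xᵢ` of the allocation vector. -/
def Allocation.entry {n : ℕ} (x : Allocation n) (i : Fin n) : ℝ := if x i = true then 1 else 0

/-- The joint law of the independent valuations. -/
def jointLaw {n : ℕ} (D : Fin n → ValuationDist) : Measure (Fin n → ℝ) :=
  Measure.pi fun i => (D i).law

/-- The possible valuation profiles, `∏ᵢ [0, bᵢ]`. -/
def typeSpace {n : ℕ} (D : Fin n → ValuationDist) : Set (Fin n → ℝ) :=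
  {v | ∀ i, v i ∈ Set.Icc 0 (D i).b}

/-- The data of a (possibly randomized) direct mechanism: on the reported profile `v`, the
allocation `x` is chosen with probability `lottery v x`, and agent `i` burns the payment
`pay v i` (in expectation over the randomization of the mechanism). -/
structure DirectMechanism (n : ℕ) where
  lottery : (Fin n → ℝ) → Allocation n → ℝ
  pay : (Fin n → ℝ) → Fin n → ℝ

namespace DirectMechanism

variable {n : ℕ}

/-- `xᵢ(v)`: the probability that agent `i` is served at the profile `v`. -/
def alloc (M : DirectMechanism n) (v : Fin n → ℝ) (i : Fin n) : ℝ :=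
  ∑ x : Allocation n, M.lottery v x * x.entry i

/-- The interim allocation `xᵢ(z) = E_{v₋ᵢ}[xᵢ(z, v₋ᵢ)]`. -/
def interimAlloc (M : DirectMechanism n) (D : Fin n → ValuationDist) (i : Fin n) (z : ℝ) : ℝ :=
  ∫ v, M.alloc (Function.update v i z) i ∂(jointLaw D)

/-- The interim payment `pᵢ(z) = E_{v₋ᵢ}[pᵢ(z, v₋ᵢ)]`. -/
def interimPay (M : DirectMechanism n) (D : Fin n → ValuationDist) (i : Fin n) (z : ℝ) : ℝ :=
  ∫ v, M.pay (Function.update v i z) i ∂(jointLaw D)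

/-- `M` is an admissible mechanism for agents with valuation distributions `D` and the set `X` of
feasible allocations. (The last four conditions imply that `0 ≤ pᵢ(z) ≤ z xᵢ(z) ≤ bᵢ`, so that the
payments are integrable with respect to the joint law as well.) -/
structure IsAdmissible (M : DirectMechanism n) (D : Fin n → ValuationDist)
    (X : Set (Allocation n)) : Prop where
  measurable_lottery : ∀ x, Measurable fun v => M.lottery v x
  lottery_mem : ∀ v, M.lottery v ∈ stdSimplex ℝ (Allocation n)
  /-- Only feasible allocations are ever chosen. -/
  feasible : ∀ v ∈ typeSpace D, ∀ x, 0 < M.lottery v x → x ∈ X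
  measurable_pay : ∀ i, Measurable fun v => M.pay v i
  /-- The expected payment of every type is well defined. -/
  integrable_pay : ∀ i, ∀ z ∈ Set.Icc 0 (D i).b,
    Integrable (fun v => M.pay (Function.update v i z) i) (jointLaw D)
  /-- There are no positive transfers to the agents. -/
  pay_nonneg : ∀ v ∈ typeSpace D, ∀ i, 0 ≤ M.pay v i
  /-- Bayesian incentive compatibility: truthtelling is a Bayes-Nash equilibrium. -/
  incentiveCompatible : ∀ i, ∀ z ∈ Set.Icc 0 (D i).b, ∀ w ∈ Set.Icc 0 (D i).b,
    z * M.interimAlloc D i w - M.interimPay D i w ≤ z * M.interimAlloc D i z - M.interimPay D i z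
  /-- Ex interim individual rationality. -/
  individuallyRational : ∀ i, ∀ z ∈ Set.Icc 0 (D i).b,
    0 ≤ z * M.interimAlloc D i z - M.interimPay D i z

/-- The expected residual surplus `E[∑ᵢ (vᵢ xᵢ(v) - pᵢ(v)) - c(x(v))]`. -/
def expectedResidualSurplus (M : DirectMechanism n) (D : Fin n → ValuationDist)
    (c : Allocation n → ℝ) : ℝ :=
  ∫ v, (∑ i, (v i * M.alloc v i - M.pay v i) - ∑ x : Allocation n, M.lottery v x * c x)
    ∂(jointLaw D)

/-- `M` is optimal: it is admissible, and no admissible mechanism has a larger expected residual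
surplus. -/
def IsOptimal (M : DirectMechanism n) (D : Fin n → ValuationDist) (X : Set (Allocation n))
    (c : Allocation n → ℝ) : Prop :=
  M.IsAdmissible D X ∧ ∀ M' : DirectMechanism n, M'.IsAdmissible D X →
    M'.expectedResidualSurplus D c ≤ M.expectedResidualSurplus D c

end DirectMechanism

/-- The ironed virtual surplus `∑ᵢ ϑ̄ᵢ(vᵢ) xᵢ - c(x)` of the allocation `x` at the profile `v`. -/
def ironedVirtualSurplus {n : ℕ} (D : Fin n → ValuationDist) (c : Allocation n → ℝ)
    (v : Fin n → ℝ) (x : Allocation n) : ℝ :=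
  ∑ i, (D i).ironed (v i) * x.entry i - c x

end MoneyBurning

end

/-! Fix an agent and drop its index. Incentive compatibility says that the interim allocation `x` is
a subgradient of the interim utility `u`, so `x` is monotone and `u(z) = u(0) + ∫₀^z x`. Individual
rationality and nonnegative payments force `u(0) = 0`, and Fubini turns the expected utility into
`E[ϑ x]` (`integral_utility`). Residual surplus is thus expected virtual surplus.

Ironing compares `E[ϑ x]` with `E[ϑ̄ x]`. By the layer-cake formula the difference is an average
over `t ∈ (0, 1]` of integrals of `ϑ - ϑ̄` over `{x > t}`. Up to null sets this is an upper interval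
`(a, b]`, and as `G` and `H` agree at `1` the integral equals `-(H - G)(F a) ≤ 0`. Hence `E[ϑ x] ≤
E[ϑ̄ x]` for every admissible mechanism. Where `G < H`, the hull is affine nearby
(`exists_affine_eq_G`), so `ϑ̄` is locally constant; the second condition makes `x` locally constant
there, no threshold `a` falls there, and equality holds.

The ironed virtual surplus thus bounds every mechanism, and the given one attains its own bound
while maximizing the ironed surplus pointwise. -/

namespace MoneyBurning

namespace ValuationDist

open Set Filter Topology

/-! ### Law and distribution function of one agent -/

theorem law_absolutelyContinuous (D : ValuationDist) : D.law ≪ volume :=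
  withDensity_absolutelyContinuous _ _

instance nullSingletonClass_law (D : ValuationDist) : NullSingletonClass D.law :=
  ⟨fun x => D.law_absolutelyContinuous (measure_singleton x)⟩

theorem ae_mem_Icc (D : ValuationDist) : ∀ᵐ z ∂D.law, z ∈ Icc 0 D.b := by
  rw [ae_iff]
  change D.law (Icc 0 D.b)ᶜ = 0
  rw [law, withDensity_apply _ measurableSet_Icc.compl,
    setLIntegral_congr_fun (g := fun _ => 0) measurableSet_Icc.compl
      (fun z hz => by simp [D.f_zero z hz])]
  simp

theorem f_nonneg (D : ValuationDist) (z : ℝ) : 0 ≤ D.f z := by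
  by_cases hz : z ∈ Icc 0 D.b
  · exact (D.f_pos z hz).le
  · rw [D.f_zero z hz]

theorem integrable_law_iff (D : ValuationDist) (φ : ℝ → ℝ) :
    Integrable φ D.law ↔ Integrable (fun z => D.f z * φ z) volume := by
  rw [law, integrable_withDensity_iff_integrable_smul' D.measurable_f.ennreal_ofReal (by simp)]
  simp [ENNReal.toReal_ofReal (D.f_nonneg _)]

theorem integral_law (D : ValuationDist) (φ : ℝ → ℝ) :
    ∫ z, φ z ∂D.law = ∫ z, D.f z * φ z := by
  rw [law, integral_withDensity_eq_integral_toReal_smul D.measurable_f.ennreal_ofReal (by simp)]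
  simp [ENNReal.toReal_ofReal (D.f_nonneg _)]

theorem F_eq (D : ValuationDist) (z : ℝ) : D.F z = D.law.real (Iic z) :=
  ProbabilityTheory.cdf_eq_real _ _

theorem monotone_F (D : ValuationDist) : Monotone D.F :=
  ProbabilityTheory.monotone_cdf _

theorem measurable_F (D : ValuationDist) : Measurable D.F := D.monotone_F.measurable

theorem F_nonneg (D : ValuationDist) (z : ℝ) : 0 ≤ D.F z := ProbabilityTheory.cdf_nonneg _ _

theorem F_le_one (D : ValuationDist) (z : ℝ) : D.F z ≤ 1 := ProbabilityTheory.cdf_le_one _ _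

theorem F_sub (D : ValuationDist) {z w : ℝ} (h : z ≤ w) :
    D.F w - D.F z = D.law.real (Ioc z w) := by
  rw [F_eq, F_eq, show Ioc z w = Iic w \ Iic z by ext y; simp [and_comm],
    measureReal_sdiff (Iic_subset_Iic.2 h) measurableSet_Iic]

theorem F_zero (D : ValuationDist) : D.F 0 = 0 := by
  rw [F_eq, measureReal_def, ← measure_congr (Iio_ae_eq_Iic (μ := D.law) (a := 0)),
    measure_mono_null (t := (Icc 0 D.b)ᶜ) _ D.ae_mem_Icc]
  · simp
  · intro z hz h
    exact absurd h.1 (not_le.2 hz)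

theorem F_b (D : ValuationDist) : D.F D.b = 1 := by
  have h : D.law (Iic D.b) = 1 := by
    rw [← mem_ae_iff_prob_eq_one measurableSet_Iic]
    filter_upwards [D.ae_mem_Icc] with z hz using hz.2
  rw [F_eq, measureReal_def, h, ENNReal.toReal_one]

/-- A positive density gives every nondegenerate interval inside `[0, b]` positive mass. -/
theorem strictMonoOn_F (D : ValuationDist) : StrictMonoOn D.F (Icc 0 D.b) := by
  intro z hz w hw hzw
  rw [← sub_pos, D.F_sub hzw.le, measureReal_def, ENNReal.toReal_pos_iff]
  refine ⟨?_, measure_lt_top _ _⟩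
  rw [law, withDensity_apply _ measurableSet_Ioc, setLIntegral_pos_iff
    D.measurable_f.ennreal_ofReal]
  have : Ioc z w ⊆ Function.support (fun z => ENNReal.ofReal (D.f z)) := fun y hy => by
    simpa using D.f_pos y ⟨hz.1.trans hy.1.le, hy.2.trans hw.2⟩
  rw [inter_eq_right.2 this]
  simpa using hzw

/-- The jump of the distribution function at a point is the mass of that point, and the law has no
atoms. -/
theorem continuous_F (D : ValuationDist) : Continuous D.F := by
  rw [continuous_iff_continuousAt]
  intro z
  have h : (ProbabilityTheory.cdf D.law).measure {z} = 0 := by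
    rw [ProbabilityTheory.measure_cdf, measure_singleton]
  rw [StieltjesFunction.measure_singleton, ENNReal.ofReal_eq_zero] at h
  refine (ProbabilityTheory.monotone_cdf D.law).continuousAt_iff_leftLim_eq_rightLim.2 ?_
  rw [StieltjesFunction.rightLim_eq]
  exact le_antisymm ((ProbabilityTheory.monotone_cdf D.law).leftLim_le le_rfl) (by linarith)

theorem F_mem_Ioo (D : ValuationDist) {z : ℝ} (hz : z ∈ Ioo 0 D.b) : D.F z ∈ Ioo 0 1 := by
  have h := D.strictMonoOn_F
  refine ⟨?_, ?_⟩
  · rw [← D.F_zero]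
    exact h (left_mem_Icc.2 D.b_pos.le) (Ioo_subset_Icc_self hz) hz.1
  · rw [← D.F_b]
    exact h (Ioo_subset_Icc_self hz) (right_mem_Icc.2 D.b_pos.le) hz.2

theorem exists_F_eq (D : ValuationDist) {q : ℝ} (hq : q ∈ Icc 0 1) :
    ∃ z ∈ Icc 0 D.b, D.F z = q := by
  have := intermediate_value_Icc D.b_pos.le D.continuous_F.continuousOn
  rw [D.F_zero, D.F_b] at this
  exact this hq

theorem Finv_F (D : ValuationDist) {z : ℝ} (hz : z ∈ Icc 0 D.b) : D.Finv (D.F z) = z := by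
  have : {w | w ∈ Icc 0 D.b ∧ D.F z ≤ D.F w} = Icc z D.b := by
    ext w
    refine ⟨fun h => ⟨(D.strictMonoOn_F.le_iff_le hz h.1).1 h.2, h.1.2⟩,
      fun h => ⟨⟨hz.1.trans h.1, h.2⟩, D.monotone_F h.1⟩⟩
  rw [Finv, this, csInf_Icc hz.2]

theorem monotoneOn_Finv (D : ValuationDist) : MonotoneOn D.Finv (Icc 0 1) := by
  intro q hq r hr hqr
  obtain ⟨z, hz, rfl⟩ := D.exists_F_eq hq
  obtain ⟨w, hw, rfl⟩ := D.exists_F_eq hr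
  rw [D.Finv_F hz, D.Finv_F hw]
  exact (D.strictMonoOn_F.le_iff_le hz hw).1 hqr

/-- The distribution function of a continuous law transports it to the uniform law. -/
theorem map_F_law (D : ValuationDist) : D.law.map D.F = volume.restrict (Ioc 0 1) := by
  have : IsProbabilityMeasure (D.law.map D.F) :=
    Measure.isProbabilityMeasure_map D.measurable_F.aemeasurable
  refine Measure.ext_of_Iic _ _ fun q => ?_
  rw [Measure.map_apply D.measurable_F measurableSet_Iic, Measure.restrict_apply measurableSet_Iic]
  rcases lt_or_ge q 0 with h0 | h0
  · rw [show D.F ⁻¹' Iic q = ∅ from eq_empty_of_forall_notMem fun z hz =>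
        absurd (D.F_nonneg z) (not_le.2 (lt_of_le_of_lt hz h0)),
      show Iic q ∩ Ioc 0 1 = ∅ from eq_empty_of_forall_notMem fun z hz =>
        absurd hz.2.1 (not_lt.2 (hz.1.trans h0.le))]
    simp
  rcases le_or_gt q 1 with h1 | h1
  · obtain ⟨z, hz, rfl⟩ := D.exists_F_eq ⟨h0, h1⟩
    rw [show Iic (D.F z) ∩ Ioc 0 1 = Ioc 0 (D.F z) by
        ext y; constructor
        · exact fun h => ⟨h.2.1, h.1⟩
        · exact fun h => ⟨h.2, h.1, h.2.trans h1⟩, Real.volume_Ioc, sub_zero,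
      show ENNReal.ofReal (D.F z) = D.law (Iic z) from ProbabilityTheory.ofReal_cdf _ _]
    refine measure_congr ?_
    filter_upwards [D.ae_mem_Icc] with w hw
    exact propext ⟨fun h => (D.strictMonoOn_F.le_iff_le hw hz).1 h, fun h => D.monotone_F h⟩
  · rw [show D.F ⁻¹' Iic q = univ from eq_univ_of_forall fun z => (D.F_le_one z).trans h1.le,
      inter_eq_right.2 fun z hz => hz.2.trans h1.le]
    simp

/-! ### The virtual valuation and its primitive in quantile space -/

theorem measurable_virtualValue (D : ValuationDist) : Measurable D.virtualValue :=
  (measurable_const.sub D.measurable_F).div D.measurable_f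

theorem virtualValue_nonneg (D : ValuationDist) (z : ℝ) : 0 ≤ D.virtualValue z :=
  div_nonneg (sub_nonneg.2 (D.F_le_one z)) (D.f_nonneg z)

theorem f_mul_virtualValue (D : ValuationDist) (z : ℝ) :
    D.f z * D.virtualValue z = (Icc 0 D.b).indicator (fun z => 1 - D.F z) z := by
  by_cases hz : z ∈ Icc 0 D.b
  · rw [indicator_of_mem hz, virtualValue, mul_div_cancel₀ _ (D.f_pos z hz).ne']
  · rw [indicator_of_notMem hz, D.f_zero z hz, zero_mul]

/-- No lower bound on `f` is assumed, so `ϑ` need not be bounded; the weight `f` cancels the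
denominator and leaves `1 - F` on a compact interval. -/
theorem integrable_virtualValue (D : ValuationDist) : Integrable D.virtualValue D.law := by
  rw [D.integrable_law_iff]
  simp_rw [D.f_mul_virtualValue]
  rw [integrable_indicator_iff measurableSet_Icc]
  exact (continuous_const.sub D.continuous_F).continuousOn.integrableOn_Icc

theorem aestronglyMeasurable_h (D : ValuationDist) :
    AEStronglyMeasurable D.h (volume.restrict (Ioc 0 1)) := by
  refine (D.measurable_virtualValue.comp_aemeasurable ?_).aestronglyMeasurable
  exact aemeasurable_restrict_of_monotoneOn measurableSet_Ioc
    (D.monotoneOn_Finv.mono Ioc_subset_Icc_self)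

theorem h_F_ae_eq (D : ValuationDist) : D.h ∘ D.F =ᵐ[D.law] D.virtualValue := by
  filter_upwards [D.ae_mem_Icc] with z hz
  simp [h, D.Finv_F hz]

theorem integrableOn_h (D : ValuationDist) : IntegrableOn D.h (Ioc 0 1) := by
  have hm := D.aestronglyMeasurable_h
  rw [← D.map_F_law] at hm
  rw [IntegrableOn, ← D.map_F_law, integrable_map_measure hm D.measurable_F.aemeasurable]
  exact D.integrable_virtualValue.congr D.h_F_ae_eq.symm

/-- Change of variables `q = F z`. -/
theorem intervalIntegral_F (D : ValuationDist) {φ : ℝ → ℝ} (hφ : IntegrableOn φ (Ioc 0 1))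
    {z : ℝ} (hz : z ∈ Icc 0 D.b) :
    ∫ q in (0 : ℝ)..D.F z, φ q = ∫ w in Ioc 0 z, φ (D.F w) ∂D.law := by
  rw [intervalIntegral.integral_of_le (D.F_nonneg z),
    show Ioc 0 (D.F z) = Ioc 0 (D.F z) ∩ Ioc 0 1 from
      (inter_eq_left.2 (Ioc_subset_Ioc_right (D.F_le_one z))).symm,
    ← Measure.restrict_restrict measurableSet_Ioc, ← D.map_F_law,
    setIntegral_map measurableSet_Ioc
      (by rw [D.map_F_law]; exact hφ.aestronglyMeasurable) D.measurable_F.aemeasurable]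
  refine setIntegral_congr_set ?_
  have h0 : ∀ᵐ w ∂D.law, w ≠ 0 := by
    simp [ae_iff, measure_singleton]
  filter_upwards [D.ae_mem_Icc, h0] with w hw hw0
  refine propext ⟨fun h => ⟨lt_of_le_of_ne hw.1 hw0.symm,
    (D.strictMonoOn_F.le_iff_le hw hz).1 h.2⟩, fun h => ⟨?_, D.monotone_F h.2⟩⟩
  rw [← D.F_zero]
  exact D.strictMonoOn_F (left_mem_Icc.2 D.b_pos.le) hw h.1

theorem H_F (D : ValuationDist) {z : ℝ} (hz : z ∈ Icc 0 D.b) :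
    D.H (D.F z) = ∫ w in Ioc 0 z, D.virtualValue w ∂D.law := by
  rw [H, D.intervalIntegral_F D.integrableOn_h hz]
  exact integral_congr_ae (ae_restrict_of_ae D.h_F_ae_eq)

theorem H_zero (D : ValuationDist) : D.H 0 = 0 := by simp [H]

theorem H_nonneg (D : ValuationDist) {q : ℝ} (hq : q ∈ Icc 0 1) : 0 ≤ D.H q := by
  obtain ⟨z, hz, rfl⟩ := D.exists_F_eq hq
  rw [D.H_F hz]
  exact integral_nonneg fun w => D.virtualValue_nonneg w

theorem continuousOn_H (D : ValuationDist) : ContinuousOn D.H (Icc 0 1) := by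
  have := intervalIntegral.continuousOn_primitive_interval (f := D.h) (a := 0) (b := 1)
    (μ := volume) (by rw [uIcc_of_le zero_le_one, integrableOn_Icc_iff_integrableOn_Ioc]
                      exact D.integrableOn_h)
  rwa [uIcc_of_le zero_le_one] at this

/-! ### The convex hull -/

theorem le_G (D : ValuationDist) {φ : ℝ → ℝ} (hφ : ConvexOn ℝ (Icc 0 1) φ)
    (hle : ∀ r ∈ Icc (0 : ℝ) 1, φ r ≤ D.H r) {q : ℝ} (hq : q ∈ Icc (0 : ℝ) 1) : φ q ≤ D.G q := by
  refine le_csSup ⟨D.H q, ?_⟩ ⟨φ, hφ, hle, rfl⟩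
  rintro _ ⟨ψ, -, hψ, rfl⟩
  exact hψ q hq

theorem convexOn_zero_le_H (D : ValuationDist) :
    ConvexOn ℝ (Icc 0 1) (fun _ : ℝ => (0 : ℝ)) ∧ ∀ r ∈ Icc (0 : ℝ) 1, 0 ≤ D.H r :=
  ⟨convexOn_const 0 (convex_Icc 0 1), fun _ hr => D.H_nonneg hr⟩

/-- The zero function is a convex minorant because `H ≥ 0`; this keeps the real supremum from being
one over the empty set. -/
theorem G_le_of_forall (D : ValuationDist) {q y : ℝ}
    (hy : ∀ φ : ℝ → ℝ, ConvexOn ℝ (Icc 0 1) φ → (∀ r ∈ Icc (0 : ℝ) 1, φ r ≤ D.H r) → φ q ≤ y) :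
    D.G q ≤ y := by
  refine csSup_le ⟨0, _, D.convexOn_zero_le_H.1, D.convexOn_zero_le_H.2, rfl⟩ ?_
  rintro _ ⟨φ, hφ, hle, rfl⟩
  exact hy φ hφ hle

theorem G_le_H (D : ValuationDist) {q : ℝ} (hq : q ∈ Icc (0 : ℝ) 1) : D.G q ≤ D.H q :=
  D.G_le_of_forall fun _ _ hle => hle q hq

theorem G_nonneg (D : ValuationDist) {q : ℝ} (hq : q ∈ Icc (0 : ℝ) 1) : 0 ≤ D.G q :=
  D.le_G D.convexOn_zero_le_H.1 D.convexOn_zero_le_H.2 hq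

theorem G_zero (D : ValuationDist) : D.G 0 = 0 :=
  le_antisymm ((D.G_le_H (left_mem_Icc.2 zero_le_one)).trans_eq D.H_zero)
    (D.G_nonneg (left_mem_Icc.2 zero_le_one))

theorem convexOn_G (D : ValuationDist) : ConvexOn ℝ (Icc 0 1) D.G := by
  refine ⟨convex_Icc 0 1, fun x hx y hy a b ha hb hab => D.G_le_of_forall fun φ hφ hle => ?_⟩
  refine (hφ.2 hx hy ha hb hab).trans ?_
  simp only [smul_eq_mul]
  gcongr
  · exact D.le_G hφ hle hx
  · exact D.le_G hφ hle hy

theorem convexOn_affine (s t : ℝ) {S : Set ℝ} (hS : Convex ℝ S) :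
    ConvexOn ℝ S fun r => s * r + t := by
  refine ⟨hS, fun x _ y _ a b _ _ hab => le_of_eq ?_⟩
  simp only [smul_eq_mul]
  linear_combination (-t) * hab

/-- Near the end point `1` the hull `G` is bounded below by steep affine minorants of `H`. -/
theorem exists_affine_le_G (D : ValuationDist) {ε : ℝ} (hε : 0 < ε) :
    ∃ C, ∀ r ∈ Icc (0 : ℝ) 1, C * r + (D.H 1 - ε - C) ≤ D.G r := by
  have h1 : (1 : ℝ) ∈ Icc (0 : ℝ) 1 := right_mem_Icc.2 zero_le_one
  obtain ⟨δ, hδ, hδH⟩ := Metric.continuousWithinAt_iff.1 (D.continuousOn_H 1 h1) ε hε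
  have hH1 := D.H_nonneg h1
  -- The minorant is `H 1 - ε - C (1 - r)`. Within `δ` of `1` it lies below `H` by continuity;
  -- farther away `C (1 - r) ≥ H 1`, so it is negative while `H ≥ 0`.
  refine ⟨D.H 1 / δ, fun r hr => D.le_G (convexOn_affine _ _ (convex_Icc 0 1)) (fun r hr => ?_) hr⟩
  have hC : 0 ≤ D.H 1 / δ := div_nonneg hH1 hδ.le
  rcases lt_or_ge (1 - r) δ with h | h
  · have := hδH hr (by rw [Real.dist_eq, abs_sub_comm, abs_of_nonneg (sub_nonneg.2 hr.2)]; exact h)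
    rw [Real.dist_eq, abs_lt] at this
    have : D.H 1 / δ * (1 - r) ≥ 0 := mul_nonneg hC (sub_nonneg.2 hr.2)
    linarith
  · have h2 : D.H 1 / δ * δ ≤ D.H 1 / δ * (1 - r) := mul_le_mul_of_nonneg_left h hC
    rw [div_mul_cancel₀ _ hδ.ne'] at h2
    have := D.H_nonneg hr
    linarith

theorem G_one (D : ValuationDist) : D.G 1 = D.H 1 := by
  have h1 : (1 : ℝ) ∈ Icc (0 : ℝ) 1 := right_mem_Icc.2 zero_le_one
  refine le_antisymm (D.G_le_H h1) (le_of_forall_pos_le_add fun ε hε => ?_)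
  obtain ⟨C, hC⟩ := D.exists_affine_le_G hε
  have := hC 1 h1
  linarith

/-- Convexity gives continuity only in the interior. At `0` the hull is squeezed between `0` and
`H`, at `1` between steep affine minorants and `H`. -/
theorem continuousOn_G (D : ValuationDist) : ContinuousOn D.G (Icc 0 1) := by
  intro q hq
  rcases eq_or_lt_of_le hq.1 with rfl | h0
  · have hH : Tendsto D.H (𝓝[Icc 0 1] 0) (𝓝 0) := by
      simpa [ContinuousWithinAt, H_zero] using D.continuousOn_H 0 hq
    rw [ContinuousWithinAt, G_zero]
    refine tendsto_of_tendsto_of_tendsto_of_le_of_le' tendsto_const_nhds hH ?_ ?_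
    · exact eventually_mem_nhdsWithin.mono fun q hq => D.G_nonneg hq
    · exact eventually_mem_nhdsWithin.mono fun q hq => D.G_le_H hq
  rcases eq_or_lt_of_le hq.2 with rfl | h1
  · have hH : Tendsto D.H (𝓝[Icc 0 1] 1) (𝓝 (D.H 1)) := D.continuousOn_H 1 hq
    rw [ContinuousWithinAt, G_one]
    refine tendsto_order.2 ⟨fun a ha => ?_, fun a ha => ?_⟩
    · obtain ⟨C, hC⟩ := D.exists_affine_le_G (half_pos (sub_pos.2 ha))
      have hc : Tendsto (fun r => C * r + (D.H 1 - (D.H 1 - a) / 2 - C)) (𝓝[Icc 0 1] 1)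
          (𝓝 (C * 1 + (D.H 1 - (D.H 1 - a) / 2 - C))) :=
        ((by fun_prop : Continuous fun r => C * r + (D.H 1 - (D.H 1 - a) / 2 - C)).tendsto
          1).mono_left nhdsWithin_le_nhds
      filter_upwards [hc.eventually (lt_mem_nhds (a := a) (by linarith)),
        eventually_mem_nhdsWithin] with r hr hr'
      exact hr.trans_le (hC r hr')
    · filter_upwards [hH.eventually (gt_mem_nhds ha), eventually_mem_nhdsWithin] with r hr hr'
      exact (D.G_le_H hr').trans_lt hr
  · have := D.convexOn_G.continuousOn_interior
    rw [interior_Icc] at this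
    exact (this.continuousAt (Ioo_mem_nhds h0 h1)).continuousWithinAt

/-! ### The derivative of the hull -/

theorem g_of_lt_one (D : ValuationDist) {q : ℝ} (hq : q < 1) :
    D.g q = derivWithin D.G (Ioi q) q := if_pos hq

theorem hasDerivWithinAt_G (D : ValuationDist) {q : ℝ} (hq : q ∈ Ioo (0 : ℝ) 1) :
    HasDerivWithinAt D.G (D.g q) (Ioi q) q := by
  rw [D.g_of_lt_one hq.2]
  exact D.convexOn_G.hasDerivWithinAt_rightDeriv_of_mem_interior (by rwa [interior_Icc])

/-- Right slopes at `q` are at least the slope of the chord from the origin, which is nonnegative.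
-/
theorem g_nonneg (D : ValuationDist) {q : ℝ} (hq : q ∈ Ioo (0 : ℝ) 1) : 0 ≤ D.g q := by
  have hd := D.hasDerivWithinAt_G hq
  rw [hasDerivWithinAt_iff_tendsto_slope' self_notMem_Ioi] at hd
  refine ge_of_tendsto hd ?_
  filter_upwards [Ioo_mem_nhdsGT hq.2] with r hr
  have h0 : (0 : ℝ) ∈ Icc (0 : ℝ) 1 := left_mem_Icc.2 zero_le_one
  have h := D.convexOn_G.slope_mono_adjacent h0 ⟨hq.1.le.trans hr.1.le, hr.2.le⟩ hq.1 hr.1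
  rw [slope_def_field]
  refine le_trans ?_ h
  rw [D.G_zero]
  exact div_nonneg (by simpa using D.G_nonneg ⟨hq.1.le, hq.2.le⟩) (by linarith [hq.1])

theorem integrableOn_g (D : ValuationDist) : IntegrableOn D.g (Ioc 0 1) :=
  intervalIntegral.integrableOn_deriv_right_of_nonneg D.continuousOn_G
    (fun _ hq => D.hasDerivWithinAt_G hq) fun _ hq => D.g_nonneg hq

theorem integral_g (D : ValuationDist) {q : ℝ} (hq : q ∈ Icc (0 : ℝ) 1) :
    ∫ r in (0 : ℝ)..q, D.g r = D.G q := by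
  rw [intervalIntegral.integral_eq_sub_of_hasDeriv_right_of_le hq.1
    (D.continuousOn_G.mono (Icc_subset_Icc_right hq.2))
    (fun r hr => D.hasDerivWithinAt_G ⟨hr.1, hr.2.trans_le hq.2⟩), G_zero, sub_zero]
  rw [intervalIntegrable_iff_integrableOn_Ioc_of_le hq.1]
  exact D.integrableOn_g.mono_set (Ioc_subset_Ioc_right hq.2)

/-- The convex hull is affine near every point where it lies strictly below `H`. -/
theorem exists_affine_eq_G (D : ValuationDist) {q : ℝ} (hq : q ∈ Ioo (0 : ℝ) 1)
    (hlt : D.G q < D.H q) : ∃ s t, ∀ᶠ r in 𝓝 q, D.G r = s * r + t := by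
  have hnhds := Icc_mem_nhds hq.1 hq.2
  -- A level `m` separates `G` from `H` on a whole interval around `q`, so the chord of `G` over
  -- that interval, being below `m`, stays below `H`.
  obtain ⟨m, hGm, hmH⟩ := exists_between hlt
  have hG := ((D.continuousOn_G).continuousAt hnhds).eventually (gt_mem_nhds hGm)
  have hH := ((D.continuousOn_H).continuousAt hnhds).eventually (lt_mem_nhds hmH)
  obtain ⟨δ, hδ, hball⟩ := Metric.nhds_basis_closedBall.eventually_iff.1
    ((hG.and hH).and (Icc_mem_nhds hq.1 hq.2))
  rw [Real.closedBall_eq_Icc] at hball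
  set x := q - δ with hx
  set y := q + δ with hy
  have hxy : x < y := by linarith
  obtain ⟨⟨hGx, -⟩, hx01⟩ := hball (left_mem_Icc.2 hxy.le)
  obtain ⟨⟨hGy, -⟩, hy01⟩ := hball (right_mem_Icc.2 hxy.le)
  set s := (D.G y - D.G x) / (y - x) with hs
  have hsxy : s * (y - x) = D.G y - D.G x := div_mul_cancel₀ _ (sub_pos.2 hxy).ne'
  set t := D.G x - s * x with ht
  refine ⟨s, t, ?_⟩
  have hmem : Icc x y ⊆ Icc 0 1 := Icc_subset_Icc hx01.1 hy01.2
  have hchord : ∀ r, (y - x) * (s * r + t) = (y - r) * D.G x + (r - x) * D.G y := fun r => by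
    rw [ht]; linear_combination (r - x) * hsxy
  -- the chord lies above `G` between `x` and `y`, and below `G` elsewhere
  have habove : ∀ r ∈ Icc x y, D.G r ≤ s * r + t := by
    intro r hr
    rcases eq_or_lt_of_le hr.1 with rfl | h1
    · linarith
    rcases eq_or_lt_of_le hr.2 with h2 | h2
    · rw [h2]; linarith
    have := D.convexOn_G.secant_mono_aux1 hx01 hy01 h1 h2
    exact le_of_mul_le_mul_left (by linarith [hchord r]) (sub_pos.2 hxy)
  have hbelow : ∀ r ∈ Icc (0 : ℝ) 1, r ∉ Icc x y → s * r + t ≤ D.G r := by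
    intro r hr hrxy
    rcases lt_or_ge r x with h1 | h1
    · have := D.convexOn_G.secant_mono_aux1 hr hy01 h1 hxy
      exact le_of_mul_le_mul_left (by linarith [hchord r]) (sub_pos.2 hxy)
    · have h2 : y < r := not_le.1 fun h => hrxy ⟨h1, h⟩
      have := D.convexOn_G.secant_mono_aux1 hx01 hr hxy h2
      exact le_of_mul_le_mul_left (by linarith [hchord r]) (sub_pos.2 hxy)
  have hlow : ∀ r ∈ Icc x y, s * r + t < D.H r := by
    intro r hr
    refine lt_of_le_of_lt ?_ (hball hr).1.2
    refine le_of_mul_le_mul_left (a := y - x) ?_ (sub_pos.2 hxy)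
    rw [hchord]
    nlinarith [mul_le_mul_of_nonneg_left hGx.le (sub_nonneg.2 hr.2),
      mul_le_mul_of_nonneg_left hGy.le (sub_nonneg.2 hr.1)]
  -- The maximum of `G` and the chord's line is again a convex minorant of `H`; maximality of `G`
  -- puts the chord below `G`.
  have hsup : ConvexOn ℝ (Icc 0 1) (D.G ⊔ fun r => s * r + t) :=
    D.convexOn_G.sup (convexOn_affine s t (convex_Icc 0 1))
  have hsupH : ∀ r ∈ Icc (0 : ℝ) 1, (D.G ⊔ fun r => s * r + t) r ≤ D.H r := by
    intro r hr
    refine sup_le (D.G_le_H hr) ?_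
    by_cases h : r ∈ Icc x y
    · exact (hlow r h).le
    · exact (hbelow r hr h).trans (D.G_le_H hr)
  filter_upwards [Icc_mem_nhds (a := x) (b := y) (x := q) (by linarith) (by linarith)] with r hr
  exact le_antisymm (habove r hr) (le_sup_right.trans (D.le_G hsup hsupH (hmem hr)))

theorem g_eventually_eq (D : ValuationDist) {q : ℝ} (hq : q ∈ Ioo (0 : ℝ) 1)
    (hlt : D.G q < D.H q) : ∃ s, ∀ᶠ r in 𝓝 q, D.g r = s := by
  obtain ⟨s, t, h⟩ := D.exists_affine_eq_G hq hlt
  refine ⟨s, ?_⟩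
  filter_upwards [h.eventually_nhds, Iio_mem_nhds hq.2] with r hr hr1
  rw [D.g_of_lt_one hr1]
  have hd : HasDerivAt D.G s r := by
    refine HasDerivAt.congr_of_eventuallyEq ?_ hr
    simpa using ((hasDerivAt_id r).const_mul s).add_const t
  exact hd.hasDerivWithinAt.derivWithin (uniqueDiffWithinAt_Ioi r)

/-! ### Comparison of virtual and ironed virtual valuations -/

theorem integrable_ironed (D : ValuationDist) : Integrable D.ironed D.law := by
  have h := D.integrableOn_g
  rw [IntegrableOn, ← D.map_F_law] at h
  exact h.comp_measurable D.measurable_F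

theorem integral_Ioc_ironed (D : ValuationDist) {z : ℝ} (hz : z ∈ Icc 0 D.b) :
    ∫ w in Ioc 0 z, D.ironed w ∂D.law = D.G (D.F z) := by
  rw [← D.integral_g ⟨D.F_nonneg z, D.F_le_one z⟩, D.intervalIntegral_F D.integrableOn_g hz]
  rfl

/-- The integral of `ϑ - ϑ̄` over the types above `a`. -/
theorem integral_Ioc_virtualValue_sub_ironed (D : ValuationDist) {a : ℝ} (ha : a ∈ Icc 0 D.b) :
    ∫ z in Ioc a D.b, (D.virtualValue z - D.ironed z) ∂D.law
      = -(D.H (D.F a) - D.G (D.F a)) := by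
  have hint := D.integrable_virtualValue.sub D.integrable_ironed
  have hprim : ∀ z ∈ Icc 0 D.b, ∫ w in Ioc 0 z, (D.virtualValue w - D.ironed w) ∂D.law
      = D.H (D.F z) - D.G (D.F z) := fun z hz => by
    rw [integral_sub D.integrable_virtualValue.integrableOn D.integrable_ironed.integrableOn,
      D.H_F hz, D.integral_Ioc_ironed hz]
  have hunion := setIntegral_union (f := fun z => D.virtualValue z - D.ironed z) (μ := D.law)
    (Ioc_disjoint_Ioc_of_le (a := 0) (d := D.b) (le_refl a)) measurableSet_Ioc
    hint.integrableOn hint.integrableOn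
  -- The contribution of the end point `b` vanishes because `G 1 = H 1`.
  rw [Ioc_union_Ioc_eq_Ioc ha.1 ha.2, hprim _ ⟨D.b_pos.le, le_rfl⟩, hprim a ha, D.F_b, D.G_one]
    at hunion
  linarith

/-- The types whose allocation exceeds the level `t` are those above a threshold `a`. -/
theorem exists_threshold (D : ValuationDist) {x : ℝ → ℝ} (hx : MonotoneOn x (Icc 0 D.b)) (t : ℝ) :
    ∃ a ∈ Icc 0 D.b, (∀ z ∈ Icc 0 D.b, z < a → x z ≤ t) ∧ ∀ z ∈ Icc 0 D.b, a < z → t < x z := by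
  let S := {z | z ∈ Icc 0 D.b ∧ t < x z}
  by_cases hS : S.Nonempty
  · have hb : BddBelow S := ⟨0, fun z hz => hz.1.1⟩
    obtain ⟨y, hy⟩ := hS
    refine ⟨sInf S, ⟨le_csInf ⟨y, hy⟩ fun z hz => hz.1.1, (csInf_le hb hy).trans hy.1.2⟩, ?_, ?_⟩
    · intro z hz hza
      by_contra! h
      exact absurd (csInf_le hb (show z ∈ S from ⟨hz, h⟩)) (not_le.2 hza)
    · intro z hz haz
      obtain ⟨w, hw, hwz⟩ := exists_lt_of_csInf_lt ⟨y, hy⟩ haz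
      exact hw.2.trans_le (hx hw.1 hz hwz.le)
  · refine ⟨D.b, right_mem_Icc.2 D.b_pos.le, fun z hz _ => ?_, fun z hz h => ?_⟩
    · by_contra! h
      exact hS ⟨z, hz, h⟩
    · exact absurd hz.2 (not_le.2 h)

/-- Whether `a` itself belongs to the superlevel set is immaterial, as points are null. The
threshold properties are kept so that the equality case can locate `a`. -/
theorem exists_integral_superlevel_eq (D : ValuationDist) {x : ℝ → ℝ}
    (hx : MonotoneOn x (Icc 0 D.b)) (t : ℝ) :
    ∃ a ∈ Icc 0 D.b, (∀ z ∈ Icc 0 D.b, z < a → x z ≤ t) ∧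
      (∀ z ∈ Icc 0 D.b, a < z → t < x z) ∧
      ∫ z in {z | t < x z}, (D.virtualValue z - D.ironed z) ∂D.law
        = -(D.H (D.F a) - D.G (D.F a)) := by
  obtain ⟨a, ha, hlow, hhigh⟩ := D.exists_threshold hx t
  refine ⟨a, ha, hlow, hhigh, ?_⟩
  rw [← D.integral_Ioc_virtualValue_sub_ironed ha]
  refine setIntegral_congr_set ?_
  have hne : ∀ᵐ z ∂D.law, z ≠ a := by simp [ae_iff, measure_singleton]
  filter_upwards [D.ae_mem_Icc, hne] with z hz hza
  refine propext ⟨fun h => ⟨lt_of_le_of_ne (not_lt.1 fun h' => ?_) hza.symm, hz.2⟩,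
    fun h => hhigh z hz h.1⟩
  exact absurd (hlow z hz h') (not_le.2 h)

/-- Layer-cake decomposition of an expectation with a weight in `[0, 1]`. -/
theorem integral_mul_eq_integral_superlevel {α : Type*} [MeasurableSpace α] {μ : Measure α}
    [SFinite μ] {ψ x : α → ℝ} (hψ : Integrable ψ μ) (hx : Measurable x)
    (hx01 : ∀ z, x z ∈ Icc (0 : ℝ) 1) :
    ∫ z, ψ z * x z ∂μ = ∫ t in Ioc (0 : ℝ) 1, ∫ z in {z | t < x z}, ψ z ∂μ := by
  have hset : MeasurableSet {p : α × ℝ | p.2 < x p.1} :=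
    measurableSet_lt measurable_snd (hx.comp measurable_fst)
  have hlevel : ∀ z, ψ z * x z
      = ∫ t in Ioc (0 : ℝ) 1, {p : α × ℝ | p.2 < x p.1}.indicator (fun p => ψ p.1) (z, t) := by
    intro z
    have : ∀ t, {p : α × ℝ | p.2 < x p.1}.indicator (fun p => ψ p.1) (z, t)
        = (Iio (x z)).indicator (fun _ => ψ z) t := fun t => rfl
    simp_rw [this]
    rw [integral_indicator measurableSet_Iio, Measure.restrict_restrict measurableSet_Iio,
      setIntegral_const, smul_eq_mul, mul_comm]
    congr 1
    -- The length of this interval is `x z`, because the weight does not exceed `1`.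
    have : (Iio (x z) ∩ Ioc 0 1 : Set ℝ) = Ioo 0 (x z) := by
      ext t
      exact ⟨fun h => ⟨h.2.1, h.1⟩, fun h => ⟨h.2, h.1, h.2.le.trans (hx01 z).2⟩⟩
    rw [this, Real.volume_real_Ioo_of_le (hx01 z).1, sub_zero]
  simp_rw [hlevel]
  rw [integral_integral_swap]
  · refine integral_congr_ae (ae_of_all _ fun t => ?_)
    simp only
    rw [← integral_indicator (measurableSet_lt measurable_const hx)]
    rfl
  · refine Integrable.indicator ?_ hset
    exact hψ.comp_fst _

/-- Replacing the virtual valuation by the ironed one does not decrease the expected virtual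
surplus of a monotone allocation rule. -/
theorem integral_virtualValue_le_ironed (D : ValuationDist) {x : ℝ → ℝ} (hxm : Measurable x)
    (hx01 : ∀ z, x z ∈ Icc (0 : ℝ) 1) (hx : MonotoneOn x (Icc 0 D.b)) :
    ∫ z, (D.virtualValue z - D.ironed z) * x z ∂D.law ≤ 0 := by
  rw [integral_mul_eq_integral_superlevel (ψ := fun z => D.virtualValue z - D.ironed z)
    (D.integrable_virtualValue.sub D.integrable_ironed) hxm hx01]
  refine integral_nonpos fun t => ?_
  obtain ⟨a, -, -, -, h⟩ := D.exists_integral_superlevel_eq hx t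
  rw [h]
  have := D.G_le_H ⟨D.F_nonneg a, D.F_le_one a⟩
  simp only [Pi.zero_apply]
  linarith

/-- If the allocation rule is locally constant where ironing takes place, then ironing does not
change the expected virtual surplus. -/
theorem integral_virtualValue_eq_ironed (D : ValuationDist) {x : ℝ → ℝ} (hxm : Measurable x)
    (hx01 : ∀ z, x z ∈ Icc (0 : ℝ) 1) (hx : MonotoneOn x (Icc 0 D.b))
    (hconst : ∀ a ∈ Ioo 0 D.b, D.G (D.F a) < D.H (D.F a) → ∃ s, ∀ᶠ z in 𝓝 a, x z = s) :
    ∫ z, (D.virtualValue z - D.ironed z) * x z ∂D.law = 0 := by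
  rw [integral_mul_eq_integral_superlevel (ψ := fun z => D.virtualValue z - D.ironed z)
    (D.integrable_virtualValue.sub D.integrable_ironed) hxm hx01]
  refine integral_eq_zero_of_ae (ae_of_all _ fun t => ?_)
  obtain ⟨a, ha, hlow, hhigh, h⟩ := D.exists_integral_superlevel_eq hx t
  refine h.trans ?_
  rw [Pi.zero_apply, neg_eq_zero]
  rcases eq_or_lt_of_le ha.1 with rfl | h0
  · rw [D.F_zero, D.H_zero, D.G_zero, sub_zero]
  rcases eq_or_lt_of_le ha.2 with rfl | hb
  · rw [D.F_b, D.G_one, sub_self]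
  by_contra hne
  have hlt : D.G (D.F a) < D.H (D.F a) :=
    lt_of_le_of_ne (D.G_le_H ⟨D.F_nonneg a, D.F_le_one a⟩) fun h => hne (by rw [h, sub_self])
  -- A weight constant around `a` cannot be at most `t` just below `a` and exceed `t` just above it.
  obtain ⟨s, hs⟩ := hconst a ⟨h0, hb⟩ hlt
  have hev : ∀ᶠ z in 𝓝 a, x z = s ∧ z ∈ Icc 0 D.b := hs.and (Icc_mem_nhds h0 hb)
  obtain ⟨z, ⟨hz, hzmem⟩, hza⟩ := ((hev.filter_mono nhdsWithin_le_nhds).and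
    (eventually_mem_nhdsWithin (a := a) (s := Iio a))).exists
  obtain ⟨w, ⟨hw, hwmem⟩, haw⟩ := ((hev.filter_mono nhdsWithin_le_nhds).and
    (eventually_mem_nhdsWithin (a := a) (s := Ioi a))).exists
  have h1 := hlow z hzmem hza
  have h2 := hhigh w hwmem haw
  rw [hz] at h1
  rw [hw] at h2
  exact absurd h1 (not_le.2 h2)

/-- Where ironing takes place, the ironed virtual valuation is locally constant. -/
theorem ironed_hasDerivAt_zero (D : ValuationDist) {a : ℝ} (ha : a ∈ Ioo 0 D.b)
    (hlt : D.G (D.F a) < D.H (D.F a)) : ∀ᶠ z in 𝓝 a, HasDerivAt D.ironed 0 z := by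
  obtain ⟨s, hs⟩ := D.g_eventually_eq (D.F_mem_Ioo ha) hlt
  have h : ∀ᶠ z in 𝓝 a, D.ironed z = s := D.continuous_F.continuousAt.eventually hs
  filter_upwards [h.eventually_nhds] with z hz
  exact (hasDerivAt_const z s).congr_of_eventuallyEq hz

end ValuationDist

open Set Filter Topology

/-! ### Indirect utility and the envelope formula -/

theorem eventually_const_of_hasDerivAt_zero {x : ℝ → ℝ} {a : ℝ}
    (h : ∀ᶠ z in 𝓝 a, HasDerivAt x 0 z) : ∃ s, ∀ᶠ z in 𝓝 a, x z = s := by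
  obtain ⟨ε, hε, hball⟩ := Metric.eventually_nhds_iff_ball.1 h
  refine ⟨x a, ?_⟩
  filter_upwards [Metric.ball_mem_nhds a hε] with z hz
  refine (convex_ball a ε).is_const_of_fderivWithin_eq_zero (𝕜 := ℝ) (f := x)
    (fun w hw => (hball w hw).differentiableAt.differentiableWithinAt) (fun w hw => ?_)
    hz (Metric.mem_ball_self hε)
  rw [fderivWithin_of_isOpen Metric.isOpen_ball hw, (hball w hw).hasFDerivAt.fderiv]
  ext
  simp

/-- An indirect utility with subgradient `x` is the integral of `x`. -/
theorem integral_subgradient_eq {u x : ℝ → ℝ} {b : ℝ} (hx01 : ∀ z, x z ∈ Icc (0 : ℝ) 1)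
    (hx : MonotoneOn x (Icc 0 b))
    (hu : ∀ z ∈ Icc 0 b, ∀ w ∈ Icc 0 b, (w - z) * x z ≤ u w - u z) {z : ℝ} (hz : z ∈ Icc 0 b) :
    ∫ w in (0 : ℝ)..z, x w = u z - u 0 := by
  have hsub : Icc 0 z ⊆ Icc 0 b := Icc_subset_Icc_right hz.2
  have hlip : LipschitzOnWith 1 u (Icc 0 b) := by
    refine LipschitzOnWith.of_dist_le_mul fun p hp q hq => ?_
    rw [NNReal.coe_one, one_mul, Real.dist_eq, Real.dist_eq]
    have key : ∀ r s y : ℝ, y ∈ Icc (0 : ℝ) 1 → |(r - s) * y| ≤ |r - s| := fun r s y hy => by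
      rw [abs_mul, abs_of_nonneg hy.1]
      exact mul_le_of_le_one_right (abs_nonneg _) hy.2
    have h1 := (abs_le.1 (key p q _ (hx01 q))).1
    have h2 := (abs_le.1 (key q p _ (hx01 p))).1
    rw [abs_sub_comm q p] at h2
    rw [abs_le]
    exact ⟨by linarith [hu q hq p hp], by linarith [hu p hp q hq]⟩
  -- A monotone `x` has only countably many discontinuities, and `u` has derivative `x` at all other
  -- interior points.
  refine integral_eq_of_hasDerivAt_off_countable_of_le u x hz.1
    hx.countable_not_continuousWithinAt (hlip.continuousOn.mono hsub) ?_ ?_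
  · rintro w ⟨hw, hwc⟩
    have hwb : w ∈ Icc 0 b := hsub (Ioo_subset_Icc_self hw)
    have hnhds : Icc 0 b ∈ 𝓝 w := Icc_mem_nhds hw.1 (hw.2.trans_le hz.2)
    have hc : ContinuousAt x w := by
      by_contra h
      exact hwc ⟨hwb, fun h' => h (h'.continuousAt hnhds)⟩
    rw [hasDerivAt_iff_isLittleO, Asymptotics.isLittleO_iff]
    intro ε hε
    filter_upwards [hnhds, Metric.continuousAt_iff'.1 hc ε hε] with y hy hyε
    have h1 := hu w hwb y hy
    have h2 := hu y hy w hwb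
    rw [Real.dist_eq] at hyε
    rw [Real.norm_eq_abs, Real.norm_eq_abs, smul_eq_mul, abs_of_nonneg (by linarith)]
    -- Subgradients at both points squeeze the linearization error between `0` and `(x y - x w) (y -
    -- w)`.
    calc u y - u w - (y - w) * x w ≤ (x y - x w) * (y - w) := by linarith
      _ ≤ |x y - x w| * |y - w| := by rw [← abs_mul]; exact le_abs_self _
      _ ≤ ε * |y - w| := by gcongr
  · refine MonotoneOn.intervalIntegrable ?_
    rw [uIcc_of_le hz.1]
    exact hx.mono hsub

/-- The expected utility is the expected virtual surplus. -/
theorem ValuationDist.integral_utility (D : ValuationDist) {u x : ℝ → ℝ} (hxm : Measurable x)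
    (hx01 : ∀ z, x z ∈ Icc (0 : ℝ) 1)
    (hu : ∀ z ∈ Icc 0 D.b, u z = ∫ w in (0 : ℝ)..z, x w) :
    ∫ z, u z ∂D.law = ∫ z, D.virtualValue z * x z ∂D.law := by
  have hset : MeasurableSet {p : ℝ × ℝ | p.2 ≤ p.1} :=
    measurableSet_le measurable_snd measurable_fst
  have h1 : ∫ z, u z ∂D.law
      = ∫ z, (∫ w in Icc 0 D.b, {p : ℝ × ℝ | p.2 ≤ p.1}.indicator (fun p => x p.2) (z, w))
          ∂D.law := by
    refine integral_congr_ae ?_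
    filter_upwards [D.ae_mem_Icc] with z hz
    have : ∀ w, {p : ℝ × ℝ | p.2 ≤ p.1}.indicator (fun p => x p.2) (z, w)
        = (Iic z).indicator x w := fun w => rfl
    simp_rw [this]
    rw [hu z hz, integral_indicator measurableSet_Iic, Measure.restrict_restrict measurableSet_Iic,
      intervalIntegral.integral_of_le hz.1, ← integral_Icc_eq_integral_Ioc]
    congr 2
    ext w
    exact ⟨fun h => ⟨h.2, h.1, h.2.trans hz.2⟩, fun h => ⟨h.2.1, h.1⟩⟩
  -- After the swap, `x w` is weighted by the mass of the types above `w`, which is `1 - F w = f w *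
  -- ϑ w`.
  rw [h1, integral_integral_swap]
  · rw [D.integral_law]
    simp_rw [← mul_assoc, D.f_mul_virtualValue]
    have : ∀ w, (Icc 0 D.b).indicator (fun z => 1 - D.F z) w * x w
        = (Icc 0 D.b).indicator (fun z => (1 - D.F z) * x z) w := fun w => by
      rw [indicator_mul_left]
    simp_rw [this]
    rw [integral_indicator measurableSet_Icc]
    refine integral_congr_ae (ae_of_all _ fun w => ?_)
    have : ∀ z, {p : ℝ × ℝ | p.2 ≤ p.1}.indicator (fun p => x p.2) (z, w)
        = (Ici w).indicator (fun _ => x w) z := fun z => rfl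
    simp_rw [this]
    rw [integral_indicator measurableSet_Ici, setIntegral_const, smul_eq_mul]
    congr 1
    rw [measureReal_congr (Ioi_ae_eq_Ici (μ := D.law) (a := w)).symm, D.F_eq, ← compl_Iic,
      probReal_compl_eq_one_sub measurableSet_Iic]
  · refine Integrable.indicator ?_ hset
    refine Integrable.of_bound (hxm.comp measurable_snd).aestronglyMeasurable 1
      (ae_of_all _ fun p => ?_)
    rw [Real.norm_eq_abs, abs_le]
    exact ⟨by linarith [(hx01 p.2).1], (hx01 p.2).2⟩

/-! ### Independence and the joint law -/

variable {n : ℕ}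

instance isProbabilityMeasure_jointLaw (D : Fin n → ValuationDist) :
    IsProbabilityMeasure (jointLaw D) := by
  unfold jointLaw
  infer_instance

theorem ae_mem_typeSpace (D : Fin n → ValuationDist) : ∀ᵐ v ∂(jointLaw D), v ∈ typeSpace D := by
  refine ae_all_iff.2 fun i => ?_
  exact (measurePreserving_eval (fun i => (D i).law) i).quasiMeasurePreserving.ae (D i).ae_mem_Icc

theorem update_mem_typeSpace {D : Fin n → ValuationDist} {v : Fin n → ℝ} (hv : v ∈ typeSpace D)
    {i : Fin n} {z : ℝ} (hz : z ∈ Icc 0 (D i).b) : Function.update v i z ∈ typeSpace D := by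
  intro j
  rcases eq_or_ne j i with rfl | h
  · rwa [Function.update_self]
  · rw [Function.update_of_ne h]
    exact hv j

theorem measurable_update_prod (i : Fin n) :
    Measurable fun p : ℝ × (Fin n → ℝ) => Function.update p.2 i p.1 := by
  refine measurable_pi_lambda _ fun j => ?_
  rcases eq_or_ne j i with rfl | h
  · simpa using measurable_fst
  · simp only [Function.update_of_ne h]
    exact (measurable_pi_apply j).comp measurable_snd

/-- Redrawing the valuation of one agent independently does not change the joint law. -/
theorem measurePreserving_update (D : Fin n → ValuationDist) (i : Fin n) :
    MeasurePreserving (fun p : ℝ × (Fin n → ℝ) => Function.update p.2 i p.1)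
      ((D i).law.prod (jointLaw D)) (jointLaw D) := by
  refine ⟨measurable_update_prod i, (Measure.pi_eq fun s hs => ?_).symm⟩
  rw [Measure.map_apply (measurable_update_prod i) (MeasurableSet.univ_pi hs)]
  have : (fun p : ℝ × (Fin n → ℝ) => Function.update p.2 i p.1) ⁻¹' univ.pi s
      = s i ×ˢ univ.pi (Function.update s i univ) := by
    ext p
    simp only [mem_preimage, mem_univ_pi, mem_prod]
    constructor
    · intro h
      refine ⟨by simpa using h i, fun j => ?_⟩
      rcases eq_or_ne j i with rfl | hj
      · simp
      · simpa [Function.update_of_ne hj] using h j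
    · rintro ⟨h1, h2⟩ j
      rcases eq_or_ne j i with rfl | hj
      · simpa using h1
      · simpa [Function.update_of_ne hj] using h2 j
  rw [this, Measure.prod_prod, jointLaw, Measure.pi_pi,
    ← Finset.mul_prod_erase _ _ (Finset.mem_univ i),
    ← Finset.mul_prod_erase _ (fun j => (D j).law (s j)) (Finset.mem_univ i), Function.update_self,
    measure_univ, one_mul]
  congr 1
  refine Finset.prod_congr rfl fun j hj => ?_
  rw [Function.update_of_ne (Finset.ne_of_mem_erase hj)]

/-- Expectations over the joint law are computed by first fixing the valuation of agent `i`. -/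
theorem integral_jointLaw_eq (D : Fin n → ValuationDist) (i : Fin n) {φ : (Fin n → ℝ) → ℝ}
    (hφ : Integrable φ (jointLaw D)) :
    ∫ v, φ v ∂(jointLaw D)
      = ∫ z, (∫ v, φ (Function.update v i z) ∂(jointLaw D)) ∂(D i).law := by
  have hp := measurePreserving_update D i
  rw [← hp.map_eq] at hφ
  rw [← integral_prod (fun p : ℝ × (Fin n → ℝ) => φ (Function.update p.2 i p.1))
      (hφ.comp_measurable hp.measurable),
    ← integral_map hp.measurable.aemeasurable hφ.aestronglyMeasurable, hp.map_eq]

theorem Allocation.entry_mem (x : Allocation n) (i : Fin n) : x.entry i ∈ Icc (0 : ℝ) 1 := by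
  unfold Allocation.entry
  split_ifs <;> simp

theorem ValuationDist.integrable_id (D : ValuationDist) : Integrable (fun z : ℝ => z) D.law := by
  refine Integrable.of_bound measurable_id.aestronglyMeasurable D.b ?_
  filter_upwards [D.ae_mem_Icc] with z hz
  rw [Real.norm_eq_abs, abs_of_nonneg hz.1]
  exact hz.2

/-! ### Interim analysis of an admissible mechanism -/

namespace DirectMechanism.IsAdmissible

variable {M : DirectMechanism n} {D : Fin n → ValuationDist} {X : Set (Allocation n)}

theorem measurable_alloc (hM : M.IsAdmissible D X) (i : Fin n) : Measurable fun v => M.alloc v i :=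
  Finset.measurable_fun_sum _ fun x _ => (hM.measurable_lottery x).mul_const _

theorem alloc_mem (hM : M.IsAdmissible D X) (v : Fin n → ℝ) (i : Fin n) :
    M.alloc v i ∈ Icc (0 : ℝ) 1 := by
  obtain ⟨h0, h1⟩ := hM.lottery_mem v
  refine ⟨Finset.sum_nonneg fun x _ => mul_nonneg (h0 x) (x.entry_mem i).1, ?_⟩
  rw [← h1]
  exact Finset.sum_le_sum fun x _ => mul_le_of_le_one_right (h0 x) (x.entry_mem i).2

theorem norm_alloc_le (hM : M.IsAdmissible D X) (v : Fin n → ℝ) (i : Fin n) :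
    ‖M.alloc v i‖ ≤ 1 := by
  rw [Real.norm_eq_abs, abs_of_nonneg (hM.alloc_mem v i).1]
  exact (hM.alloc_mem v i).2

theorem measurable_interimAlloc (hM : M.IsAdmissible D X) (i : Fin n) :
    Measurable (M.interimAlloc D i) :=
  (((hM.measurable_alloc i).comp (measurable_update_prod i)).stronglyMeasurable.integral_prod_right'
    (ν := jointLaw D)).measurable

theorem integrable_alloc_update (hM : M.IsAdmissible D X) (i : Fin n) (z : ℝ) :
    Integrable (fun v => M.alloc (Function.update v i z) i) (jointLaw D) :=
  Integrable.of_bound ((hM.measurable_alloc i).comp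
    ((measurable_update_prod i).comp measurable_prodMk_left)).aestronglyMeasurable 1
    (ae_of_all _ fun _ => hM.norm_alloc_le _ i)

theorem interimAlloc_mem (hM : M.IsAdmissible D X) (i : Fin n) (z : ℝ) :
    M.interimAlloc D i z ∈ Icc (0 : ℝ) 1 := by
  refine ⟨integral_nonneg fun v => (hM.alloc_mem _ i).1, ?_⟩
  calc M.interimAlloc D i z ≤ ∫ _, (1 : ℝ) ∂(jointLaw D) :=
        integral_mono (hM.integrable_alloc_update i z) (integrable_const 1)
          fun v => (hM.alloc_mem _ i).2
    _ = 1 := by simp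

theorem integrable_mul_alloc (hM : M.IsAdmissible D X) (i : Fin n) {φ : ℝ → ℝ}
    (hφ : Integrable φ (D i).law) :
    Integrable (fun v => φ (v i) * M.alloc v i) (jointLaw D) := by
  have h : Integrable (fun v : Fin n → ℝ => φ (v i)) (jointLaw D) :=
    (measurePreserving_eval (fun i => (D i).law) i).integrable_comp_of_integrable hφ
  exact h.mul_bdd (c := 1) (hM.measurable_alloc i).aestronglyMeasurable
    (ae_of_all _ fun v => hM.norm_alloc_le v i)

theorem integral_mul_alloc (hM : M.IsAdmissible D X) (i : Fin n) {φ : ℝ → ℝ}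
    (hφ : Integrable φ (D i).law) :
    ∫ v, φ (v i) * M.alloc v i ∂(jointLaw D) = ∫ z, φ z * M.interimAlloc D i z ∂(D i).law := by
  rw [integral_jointLaw_eq D i (hM.integrable_mul_alloc i hφ)]
  simp only [Function.update_self, integral_const_mul]
  rfl

theorem integrable_mul_interimAlloc (hM : M.IsAdmissible D X) (i : Fin n) {φ : ℝ → ℝ}
    (hφ : Integrable φ (D i).law) :
    Integrable (fun z => φ z * M.interimAlloc D i z) (D i).law :=
  hφ.mul_bdd (c := 1) (hM.measurable_interimAlloc i).aestronglyMeasurable (ae_of_all _ fun z => by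
    rw [Real.norm_eq_abs, abs_of_nonneg (hM.interimAlloc_mem i z).1]
    exact (hM.interimAlloc_mem i z).2)

theorem pay_update_nonneg (hM : M.IsAdmissible D X) (i : Fin n) {z : ℝ} (hz : z ∈ Icc 0 (D i).b) :
    ∀ᵐ v ∂(jointLaw D), 0 ≤ M.pay (Function.update v i z) i := by
  filter_upwards [ae_mem_typeSpace D] with v hv
  exact hM.pay_nonneg _ (update_mem_typeSpace hv hz) i

theorem interimPay_nonneg (hM : M.IsAdmissible D X) (i : Fin n) {z : ℝ}
    (hz : z ∈ Icc 0 (D i).b) : 0 ≤ M.interimPay D i z :=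
  integral_nonneg_of_ae (hM.pay_update_nonneg i hz)

theorem interimPay_le (hM : M.IsAdmissible D X) (i : Fin n) {z : ℝ}
    (hz : z ∈ Icc 0 (D i).b) : M.interimPay D i z ≤ (D i).b := by
  have h1 := hM.individuallyRational i z hz
  have h2 := mul_le_of_le_one_right hz.1 (hM.interimAlloc_mem i z).2
  linarith [hz.2]

/-- By Tonelli it suffices to integrate the interim expectation of the absolute payment. Payments
being nonnegative, this is the interim payment, bounded by `b` through individual rationality. -/
theorem integrable_pay_jointLaw (hM : M.IsAdmissible D X) (i : Fin n) :
    Integrable (fun v => M.pay v i) (jointLaw D) := by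
  have hp := measurePreserving_update D i
  have hm : Measurable fun p : ℝ × (Fin n → ℝ) => M.pay (Function.update p.2 i p.1) i :=
    (hM.measurable_pay i).comp hp.measurable
  rw [← hp.integrable_comp (hM.measurable_pay i).aestronglyMeasurable]
  refine (integrable_prod_iff hm.aestronglyMeasurable).2 ⟨?_, ?_⟩
  · filter_upwards [(D i).ae_mem_Icc] with z hz using hM.integrable_pay i z hz
  · refine Integrable.of_bound
      (hm.norm.stronglyMeasurable.integral_prod_right' (ν := jointLaw D)).aestronglyMeasurable
      (D i).b ?_
    filter_upwards [(D i).ae_mem_Icc] with z hz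
    have : ∫ v, ‖M.pay (Function.update v i z) i‖ ∂(jointLaw D) = M.interimPay D i z := by
      refine integral_congr_ae ?_
      filter_upwards [hM.pay_update_nonneg i hz] with v hv
      rw [Real.norm_eq_abs, abs_of_nonneg hv]
    change ‖∫ v, ‖M.pay (Function.update v i z) i‖ ∂(jointLaw D)‖ ≤ (D i).b
    rw [this, Real.norm_eq_abs, abs_of_nonneg (hM.interimPay_nonneg i hz)]
    exact hM.interimPay_le i hz

theorem subgradient_interimUtility (hM : M.IsAdmissible D X) (i : Fin n) {z w : ℝ}
    (hz : z ∈ Icc 0 (D i).b) (hw : w ∈ Icc 0 (D i).b) :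
    (w - z) * M.interimAlloc D i z
      ≤ (w * M.interimAlloc D i w - M.interimPay D i w)
        - (z * M.interimAlloc D i z - M.interimPay D i z) := by
  linarith [hM.incentiveCompatible i w hw z hz]

/-- Adding the two incentive constraints between a pair of types cancels the payments. -/
theorem monotoneOn_interimAlloc (hM : M.IsAdmissible D X) (i : Fin n) :
    MonotoneOn (M.interimAlloc D i) (Icc 0 (D i).b) := by
  intro z hz w hw hzw
  rcases eq_or_lt_of_le hzw with rfl | hlt
  · rfl
  have h1 := hM.subgradient_interimUtility i hz hw
  have h2 := hM.subgradient_interimUtility i hw hz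
  exact le_of_mul_le_mul_left (by linarith) (sub_pos.2 hlt)

theorem integrable_utility (hM : M.IsAdmissible D X) (i : Fin n) :
    Integrable (fun v => v i * M.alloc v i - M.pay v i) (jointLaw D) :=
  (hM.integrable_mul_alloc i (D i).integrable_id).sub (hM.integrable_pay_jointLaw i)

theorem interimUtility_eq (hM : M.IsAdmissible D X) (i : Fin n) {z : ℝ}
    (hz : z ∈ Icc 0 (D i).b) :
    z * M.interimAlloc D i z - M.interimPay D i z = ∫ w in (0 : ℝ)..z, M.interimAlloc D i w := by
  have h0 : (0 : ℝ) ∈ Icc 0 (D i).b := left_mem_Icc.2 (D i).b_pos.le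
  -- Type `0` has no value for service: individual rationality forbids charging it, and no transfer
  -- can be made to it.
  have hpay : M.interimPay D i 0 = 0 := le_antisymm
    (by linarith [hM.individuallyRational i 0 h0]) (hM.interimPay_nonneg i h0)
  rw [integral_subgradient_eq (u := fun z => z * M.interimAlloc D i z - M.interimPay D i z)
    (hM.interimAlloc_mem i) (hM.monotoneOn_interimAlloc i)
    (fun z hz w hw => hM.subgradient_interimUtility i hz hw) hz, hpay]
  ring

/-- The expected utility of an agent is its expected virtual surplus. -/
theorem integral_utility (hM : M.IsAdmissible D X) (i : Fin n) :
    ∫ v, (v i * M.alloc v i - M.pay v i) ∂(jointLaw D)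
      = ∫ z, (D i).virtualValue z * M.interimAlloc D i z ∂(D i).law := by
  rw [← (D i).integral_utility (hM.measurable_interimAlloc i) (hM.interimAlloc_mem i)
    (u := fun z => z * M.interimAlloc D i z - M.interimPay D i z)
    fun z hz => hM.interimUtility_eq i hz, integral_jointLaw_eq D i (hM.integrable_utility i)]
  refine integral_congr_ae ?_
  filter_upwards [(D i).ae_mem_Icc] with z hz
  simp only [Function.update_self]
  rw [integral_sub ((hM.integrable_alloc_update i z).const_mul z) (hM.integrable_pay i z hz),
    integral_const_mul]
  rfl

theorem integral_utility_sub_ironed (hM : M.IsAdmissible D X) (i : Fin n) :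
    ∫ v, (v i * M.alloc v i - M.pay v i) ∂(jointLaw D)
        - ∫ v, (D i).ironed (v i) * M.alloc v i ∂(jointLaw D)
      = ∫ z, ((D i).virtualValue z - (D i).ironed z) * M.interimAlloc D i z ∂(D i).law := by
  rw [hM.integral_utility i, hM.integral_mul_alloc i (D i).integrable_ironed,
    ← integral_sub (hM.integrable_mul_interimAlloc i (D i).integrable_virtualValue)
      (hM.integrable_mul_interimAlloc i (D i).integrable_ironed)]
  simp only [sub_mul]

theorem integral_utility_le_ironed (hM : M.IsAdmissible D X) (i : Fin n) :
    ∫ v, (v i * M.alloc v i - M.pay v i) ∂(jointLaw D)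
      ≤ ∫ v, (D i).ironed (v i) * M.alloc v i ∂(jointLaw D) := by
  rw [← sub_nonpos, hM.integral_utility_sub_ironed i]
  exact (D i).integral_virtualValue_le_ironed (hM.measurable_interimAlloc i)
    (hM.interimAlloc_mem i) (hM.monotoneOn_interimAlloc i)

theorem integral_utility_eq_ironed (hM : M.IsAdmissible D X) (i : Fin n)
    (hflat : ∀ z ∈ Ioo 0 (D i).b,
      HasDerivAt (D i).ironed 0 z → HasDerivAt (M.interimAlloc D i) 0 z) :
    ∫ v, (v i * M.alloc v i - M.pay v i) ∂(jointLaw D)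
      = ∫ v, (D i).ironed (v i) * M.alloc v i ∂(jointLaw D) := by
  rw [← sub_eq_zero, hM.integral_utility_sub_ironed i]
  refine (D i).integral_virtualValue_eq_ironed (hM.measurable_interimAlloc i)
    (hM.interimAlloc_mem i) (hM.monotoneOn_interimAlloc i) fun a ha hlt => ?_
  refine eventually_const_of_hasDerivAt_zero ?_
  -- The ironed valuation is flat on a whole neighbourhood of `a`, so the hypothesis applies at
  -- every nearby type; this yields local constancy, not just a zero derivative at `a`.
  filter_upwards [(D i).ironed_hasDerivAt_zero ha hlt, Ioo_mem_nhds ha.1 ha.2] with z hz hz'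
  exact hflat z hz' hz

/-! ### Ironed virtual surplus of a mechanism -/

theorem integrable_cost (hM : M.IsAdmissible D X) (c : Allocation n → ℝ) :
    Integrable (fun v => ∑ x : Allocation n, M.lottery v x * c x) (jointLaw D) := by
  refine integrable_finsetSum _ fun x _ => Integrable.mul_const ?_ _
  refine Integrable.of_bound (hM.measurable_lottery x).aestronglyMeasurable 1
    (ae_of_all _ fun v => ?_)
  obtain ⟨h0, h1⟩ := hM.lottery_mem v
  rw [Real.norm_eq_abs, abs_of_nonneg (h0 x), ← h1]
  exact Finset.single_le_sum (fun y _ => h0 y) (Finset.mem_univ x)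

theorem sum_lottery_mul_ironedVirtualSurplus (M : DirectMechanism n) (D : Fin n → ValuationDist)
    (c : Allocation n → ℝ) (v : Fin n → ℝ) :
    ∑ x : Allocation n, M.lottery v x * ironedVirtualSurplus D c v x
      = ∑ i, (D i).ironed (v i) * M.alloc v i - ∑ x : Allocation n, M.lottery v x * c x := by
  simp only [ironedVirtualSurplus, mul_sub, Finset.sum_sub_distrib, alloc, Finset.mul_sum]
  rw [Finset.sum_comm]
  congr 1
  refine Finset.sum_congr rfl fun i _ => Finset.sum_congr rfl fun x _ => ?_
  ring

theorem integrable_ironedVirtualSurplus (hM : M.IsAdmissible D X) (c : Allocation n → ℝ) :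
    Integrable (fun v => ∑ x : Allocation n, M.lottery v x * ironedVirtualSurplus D c v x)
      (jointLaw D) := by
  simp_rw [sum_lottery_mul_ironedVirtualSurplus]
  exact (integrable_finsetSum _ fun i _ => hM.integrable_mul_alloc i (D i).integrable_ironed).sub
    (hM.integrable_cost c)

theorem integral_ironedVirtualSurplus (hM : M.IsAdmissible D X) (c : Allocation n → ℝ) :
    ∫ v, ∑ x : Allocation n, M.lottery v x * ironedVirtualSurplus D c v x ∂(jointLaw D)
      = ∑ i, ∫ v, (D i).ironed (v i) * M.alloc v i ∂(jointLaw D)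
        - ∫ v, ∑ x : Allocation n, M.lottery v x * c x ∂(jointLaw D) := by
  have h := fun i => hM.integrable_mul_alloc i (D i).integrable_ironed
  simp_rw [sum_lottery_mul_ironedVirtualSurplus]
  rw [integral_sub (integrable_finsetSum _ fun i _ => h i) (hM.integrable_cost c),
    integral_finsetSum _ fun i _ => h i]

theorem expectedResidualSurplus_eq (hM : M.IsAdmissible D X) (c : Allocation n → ℝ) :
    M.expectedResidualSurplus D c
      = ∑ i, ∫ v, (v i * M.alloc v i - M.pay v i) ∂(jointLaw D)
        - ∫ v, ∑ x : Allocation n, M.lottery v x * c x ∂(jointLaw D) := by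
  unfold expectedResidualSurplus
  rw [integral_sub (integrable_finsetSum _ fun i _ => hM.integrable_utility i)
    (hM.integrable_cost c), integral_finsetSum _ fun i _ => hM.integrable_utility i]

end DirectMechanism.IsAdmissible

/-! ### Pointwise maximization and optimality -/

/-- A lottery over maximizers is at least as good as every other lottery over feasible points. -/
theorem sum_mul_le_of_isMaxOn {α : Type*} [Fintype α] {p q S : α → ℝ} {X : Set α}
    (hp : p ∈ stdSimplex ℝ α) (hq : q ∈ stdSimplex ℝ α) (hpX : ∀ x, 0 < p x → x ∈ X)
    (hqX : ∀ x, 0 < q x → x ∈ X) (hmax : ∀ x, 0 < p x → IsMaxOn S X x) :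
    ∑ x, q x * S x ≤ ∑ x, p x * S x := by
  -- Any point `y` charged by `p` attains the maximum of `S` on `X`, so `S y` separates the two
  -- expectations.
  obtain ⟨y, -, hy⟩ : ∃ y ∈ Finset.univ, 0 < p y := by
    refine Finset.exists_lt_of_sum_lt ?_
    simp [hp.2]
  calc ∑ x, q x * S x ≤ ∑ x, q x * S y := Finset.sum_le_sum fun x _ => by
        rcases eq_or_lt_of_le (hq.1 x) with h | h
        · simp [← h]
        · exact mul_le_mul_of_nonneg_left (hmax y hy (hqX x h)) h.le
    _ = ∑ x, p x * S y := by rw [← Finset.sum_mul, ← Finset.sum_mul, hp.2, hq.2]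
    _ ≤ ∑ x, p x * S x := Finset.sum_le_sum fun x _ => by
        rcases eq_or_lt_of_le (hp.1 x) with h | h
        · simp [← h]
        · exact mul_le_mul_of_nonneg_left (hmax x h (hpX y hy)) h.le

end MoneyBurning

theorem theoremt (n : ℕ) (D : Fin n → MoneyBurning.ValuationDist)
    (X : Set (MoneyBurning.Allocation n)) (c : MoneyBurning.Allocation n → ℝ)
    (M : MoneyBurning.DirectMechanism n) (hM : M.IsAdmissible D X)
    (hmax : ∀ᵐ v ∂(MoneyBurning.jointLaw D), ∀ x, 0 < M.lottery v x →
      IsMaxOn (MoneyBurning.ironedVirtualSurplus D c v) X x)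
    (hflat : ∀ i, ∀ z ∈ Set.Ioo 0 (D i).b,
      HasDerivAt (D i).ironed 0 z → HasDerivAt (M.interimAlloc D i) 0 z) :
    M.IsOptimal D X c := by
  refine ⟨hM, fun M' hM' => ?_⟩
  have hle := integral_mono_ae (hM'.integrable_ironedVirtualSurplus c)
    (hM.integrable_ironedVirtualSurplus c) <| by
      filter_upwards [hmax, MoneyBurning.ae_mem_typeSpace D] with v hv hvT
      exact MoneyBurning.sum_mul_le_of_isMaxOn (hM.lottery_mem v) (hM'.lottery_mem v)
        (hM.feasible v hvT) (hM'.feasible v hvT) hv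
  rw [hM.integral_ironedVirtualSurplus c, hM'.integral_ironedVirtualSurplus c] at hle
  rw [hM.expectedResidualSurplus_eq c, hM'.expectedResidualSurplus_eq c,
    Finset.sum_congr rfl fun i _ => hM.integral_utility_eq_ironed i (hflat i)]
  -- Ironing is an inequality for the competitor and an equality for `M`; in between, the ironed
  -- surpluses, costs included, are compared by `hle`.
  exact (sub_le_sub_right
    (Finset.sum_le_sum fun i _ => hM'.integral_utility_le_ironed i) _).trans hle
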